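/- Let $R$ be a (finite, crystallographic) reduced root system in a real vector space $V$, with Weyl group $W$, weight lattice $P(R)\subset V$, and let $P(R^\vee)\supset Q(R^\vee)$ in $V^*$ be the weight lattice and the root lattice of the dual root system $R^\vee$. Let $T=\operatorname{Spec}\mathbb{C}[P(R)]$ be the complex torus with character lattice $P(R)$, so that its complex points are the homomorphisms $u:P(R)\to\mathbb{C}^\times$; the group $W$ acts on $T$ by $(w(u))(\lambda)=u(w^{-1}\lambda)$. A point $u\in T$ is called regular if its stabilizer in $W$ is trivial. For $\mu\in P(R^\vee)$ let $x_\mu\in T$ be the point $\lambda\mapsto\exp(-2\pi\sqrt{-1}\,\langle\lambda,\mu\rangle)$, and let $\bar\mu$ be the class of $\mu$ in $P(R^\vee)/Q(R^\vee)$. Fix a basis of simple roots of $R$. Let $C=\{v\in V^* : 0<\alpha(v)<1 \text{ for all positive roots } \alpha\}$ be the fundamental alcove (the product of the fundamental alcoves of the irreducible components of $R$), let $W_e=P(R^\vee)\rtimes W$ act on $V^*$ ($P(R^\vee)$ by translations $t_\mu$, $W$ linearly), and let $\Gamma_C\subset W_e$ be the subgroup of elements mapping $C$ onto itself. The projection $t_\mu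 w\mapsto\bar\mu$ restricts to an isomorphism $\xi:\Gamma_C\to P(R^\vee)/Q(R^\vee)$. Let $\psi:P(R^\vee)/Q(R^\vee)\to W$ be the composition of $\xi^{-1}$ with the projection $W_e\to W$. **Proposition.** Let $\mu\in P(R^\vee)$ and $h\in W$. There exists a regular element $u\in T$ with $h(u)=x_\mu u$ if and only if $h$ is conjugate to $\psi(\bar\mu)$ in $W$. -/

import Mathlib

noncomputable section

namespace RootPairing

variable {ι M N : Type*} [AddCommGroup M] [Module ℝ M] [AddCommGroup N] [Module ℝ N]
  (P : RootPairing ι ℝ M N)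

/-- The weight lattice `P(R)`: the vectors of `V = M` that pair integrally with every coroot. -/
def weightLattice : AddSubgroup M where
  carrier := {l | ∀ i, ∃ n : ℤ, P.toLinearMap l (P.coroot i) = n}
  zero_mem' i := ⟨0, by simp⟩
  add_mem' {x y} hx hy i := by
    obtain ⟨a, ha⟩ := hx i
    obtain ⟨c, hc⟩ := hy i
    exact ⟨a + c, by simp [ha, hc]⟩
  neg_mem' {x} hx i := by
    obtain ⟨a, ha⟩ := hx i
    exact ⟨-a, by simp [ha]⟩

/-- The coweight lattice `P(R^∨)`: the vectors of `V^* = N` that pair integrally with every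
root. It is the weight lattice of the dual root system. -/
def coweightLattice : AddSubgroup N := P.flip.weightLattice

/-- The coroot lattice `Q(R^∨)`. -/
def corootLattice : AddSubgroup N := AddSubgroup.closure (Set.range P.coroot)

/-- The finite abelian group `P(R^∨) / Q(R^∨)`. -/
abbrev CoweightQuotient : Type _ :=
  P.coweightLattice ⧸ P.corootLattice.addSubgroupOf P.coweightLattice

lemma mem_coweightLattice {v : N} :
    v ∈ P.coweightLattice ↔ ∀ i, ∃ n : ℤ, P.toLinearMap (P.root i) v = n := Iff.rfl

lemma smul_mem_weightLattice (w : P.weylGroup) {l : M} (hl : l ∈ P.weightLattice) :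
    w • l ∈ P.weightLattice := by
  obtain ⟨w, hw⟩ := w
  induction hw using weylGroup.induction generalizing l with
  | one => exact (one_smul P.weylGroup l).symm ▸ hl
  | mul x y hx hy ihx ihy =>
    have : (⟨x * y, mul_mem hx hy⟩ : P.weylGroup) • l
        = (⟨x, hx⟩ : P.weylGroup) • (⟨y, hy⟩ : P.weylGroup) • l := mul_smul x y l
    rw [this]
    exact ihx (ihy hl)
  | mem i =>
    change P.reflection i l ∈ P.weightLattice
    intro j
    obtain ⟨a, ha⟩ := hl (P.reflectionPerm i j)
    refine ⟨a, ?_⟩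
    rw [← ha, ← P.reflectionPerm_coroot i j]
    have h1 : P.toLinearMap (P.reflection i l) (P.coroot j) = P.toLinearMap l (P.coroot j) -
        P.toLinearMap l (P.coroot i) * P.toLinearMap (P.root i) (P.coroot j) := by
      rw [reflection_apply, map_sub, map_smul]
      rfl
    rw [h1, map_sub, map_smul, smul_eq_mul, mul_comm]

/-- The action of the Weyl group on `V^* = N`, contragredient to its action on `V = M`:
`⟨l, w v⟩ = ⟨w⁻¹ l, v⟩`. -/
def weylCoweightRep : P.weylGroup →* (N ≃ₗ[ℝ] N) where
  toFun w := Equiv.coweightEquiv P P ((w⁻¹ : P.weylGroup) : P.Aut)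
  map_one' := by
    ext v
    rw [inv_one]
    rfl
  map_mul' x y := by
    ext v
    rw [mul_inv_rev]
    rfl

lemma weylCoweightRep_pairing (w : P.weylGroup) (l : M) (v : N) :
    P.toLinearMap l (P.weylCoweightRep w v) = P.toLinearMap (w⁻¹ • l) v :=
  LinearMap.congr_fun (Hom.weight_coweight_transpose_apply P P v
    ((w⁻¹ : P.weylGroup) : P.Aut).toHom).symm l

lemma weylCoweightRep_ofIdx (i : ι) (v : N) :
    P.weylCoweightRep (weylGroup.ofIdx P i) v = v - P.toLinearMap (P.root i) v • P.coroot i := by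
  change Equiv.coweightEquiv P P (Equiv.reflection P i)⁻¹ v = _
  rw [Equiv.reflection_inv]
  rfl

lemma weylCoweightRep_mem (w : P.weylGroup) {v : N} (hv : v ∈ P.coweightLattice) :
    P.weylCoweightRep w v ∈ P.coweightLattice := by
  intro i
  obtain ⟨n, hn⟩ := hv (P.weylGroupToPerm w⁻¹ i)
  refine ⟨n, ?_⟩
  change P.toLinearMap (P.root i) (P.weylCoweightRep w v) = n
  rw [weylCoweightRep_pairing, weylGroup_apply_root]
  exact hn

/-- The Weyl group acts trivially on `P(R^∨) / Q(R^∨)`. -/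
lemma weylCoweightRep_sub_mem (w : P.weylGroup) {v : N} (hv : v ∈ P.coweightLattice) :
    P.weylCoweightRep w v - v ∈ P.corootLattice := by
  obtain ⟨w, hw⟩ := w
  induction hw using weylGroup.induction generalizing v with
  | one =>
    change P.weylCoweightRep 1 v - v ∈ _
    simp [zero_mem]
  | mul x y hx hy ihx ihy =>
    have h1 := ihx (P.weylCoweightRep_mem ⟨y, hy⟩ hv)
    have h2 := add_mem h1 (ihy hv)
    rw [sub_add_sub_cancel] at h2
    have hxy : (⟨x * y, mul_mem hx hy⟩ : P.weylGroup) =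
        (⟨x, hx⟩ : P.weylGroup) * (⟨y, hy⟩ : P.weylGroup) := rfl
    rw [hxy, map_mul]
    exact h2
  | mem i =>
    have := P.weylCoweightRep_ofIdx i v
    change P.weylCoweightRep (weylGroup.ofIdx P i) v - v ∈ _
    obtain ⟨n, hn⟩ := P.mem_coweightLattice.1 hv i
    rw [this, hn, sub_sub_cancel_left, Int.cast_smul_eq_zsmul]
    exact neg_mem (zsmul_mem (AddSubgroup.subset_closure (Set.mem_range_self i)) n)

/-- The action of the Weyl group on the coweight lattice, written multiplicatively. -/
def weylCoweightAut : P.weylGroup →* MulAut (Multiplicative P.coweightLattice) where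
  toFun w :=
    { toFun m := .ofAdd ⟨P.weylCoweightRep w m.toAdd, P.weylCoweightRep_mem w m.toAdd.2⟩
      invFun m := .ofAdd ⟨P.weylCoweightRep w⁻¹ m.toAdd, P.weylCoweightRep_mem w⁻¹ m.toAdd.2⟩
      left_inv m := Multiplicative.toAdd.injective <| Subtype.ext <| by
        change (P.weylCoweightRep w⁻¹ * P.weylCoweightRep w) _ = _
        rw [← map_mul]; simp
      right_inv m := Multiplicative.toAdd.injective <| Subtype.ext <| by
        change (P.weylCoweightRep w * P.weylCoweightRep w⁻¹) _ = _
        rw [← map_mul]; simp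
      map_mul' m n := Multiplicative.toAdd.injective <| Subtype.ext <|
        map_add (P.weylCoweightRep w) _ _ }
  map_one' := MulEquiv.ext fun m ↦ Multiplicative.toAdd.injective <| Subtype.ext <| by
    change P.weylCoweightRep 1 _ = _
    simp
  map_mul' x y := MulEquiv.ext fun m ↦ Multiplicative.toAdd.injective <| Subtype.ext <| by
    change P.weylCoweightRep (x * y) _ = _
    rw [map_mul]; rfl

/-- The extended affine Weyl group `W_e = P(R^∨) ⋊ W`. -/
abbrev ExtendedWeylGroup : Type _ :=
  Multiplicative P.coweightLattice ⋊[P.weylCoweightAut] P.weylGroup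

/-- `W_e` acts on `V^* = N` by affine transformations: `P(R^∨)` by translations and `W` linearly. -/
def extendedWeylAction : P.ExtendedWeylGroup →* Equiv.Perm N where
  toFun g := (P.weylCoweightRep g.right).toEquiv.trans (Equiv.addLeft (g.left.toAdd : N))
  map_one' := by
    ext v
    change ((0 : P.coweightLattice) : N) + P.weylCoweightRep 1 v = v
    simp
  map_mul' x y := by
    ext v
    change ((x.left.toAdd : N) + P.weylCoweightRep x.right (y.left.toAdd : N)) +
        P.weylCoweightRep (x.right * y.right) v =
      (x.left.toAdd : N) + P.weylCoweightRep x.right ((y.left.toAdd : N) +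
        P.weylCoweightRep y.right v)
    rw [map_mul, map_add, add_assoc]
    rfl

lemma extendedWeylAction_apply (g : P.ExtendedWeylGroup) (v : N) :
    P.extendedWeylAction g v = (g.left.toAdd : N) + P.weylCoweightRep g.right v := rfl

/-- The projection `W_e → W_e / W_a ≅ P(R^∨) / Q(R^∨)`, whose kernel is the affine Weyl group
`W_a = Q(R^∨) ⋊ W`. It sends `t_μ w` to the class of `μ`. -/
def extendedWeylToQuotient : P.ExtendedWeylGroup →* Multiplicative P.CoweightQuotient where
  toFun g := .ofAdd (QuotientAddGroup.mk g.left.toAdd)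
  map_one' := rfl
  map_mul' x y := by
    rw [← ofAdd_add, ← QuotientAddGroup.mk_add]
    refine congrArg Multiplicative.ofAdd (QuotientAddGroup.eq.2 ?_)
    rw [AddSubgroup.mem_addSubgroupOf]
    change -((x.left.toAdd : N) + P.weylCoweightRep x.right (y.left.toAdd : N)) +
      ((x.left.toAdd : N) + (y.left.toAdd : N)) ∈ P.corootLattice
    have := neg_mem (P.weylCoweightRep_sub_mem x.right y.left.toAdd.2)
    convert this using 1
    abel

variable {P} in
/-- The fundamental alcove attached to a base of the root system: the points of `V^*` at which
every positive root takes a value strictly between `0` and `1`. If `R` is irreducible this is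
`0 < α_i (v)` for all simple roots `α_i` together with `α̃ (v) < 1` for the highest root `α̃`;
in general it is the product of the fundamental alcoves of the irreducible components. -/
def Base.fundamentalAlcove (b : P.Base) : Set N :=
  {v | ∀ i, b.IsPos i → 0 < P.toLinearMap (P.root i) v ∧ P.toLinearMap (P.root i) v < 1}

variable {P} in
/-- The group `Γ_C` of elements of `W_e` that map the fundamental alcove `C` onto itself. -/
def Base.alcoveStabilizer (b : P.Base) : Subgroup P.ExtendedWeylGroup where
  carrier := {g | P.extendedWeylAction g '' b.fundamentalAlcove = b.fundamentalAlcove}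
  one_mem' := by
    change P.extendedWeylAction 1 '' _ = _
    rw [map_one, Equiv.Perm.coe_one, Set.image_id]
  mul_mem' {x y} hx hy := by
    change P.extendedWeylAction (x * y) '' _ = _
    rw [map_mul, Equiv.Perm.coe_mul, Set.image_comp]
    exact (congrArg _ hy).trans hx
  inv_mem' {x} hx := by
    change P.extendedWeylAction x⁻¹ '' _ = _
    rw [map_inv, Equiv.Perm.inv_def, Equiv.image_symm_eq_preimage]
    conv_lhs => rw [← (show P.extendedWeylAction x '' _ = _ from hx)]
    exact Set.preimage_image_eq _ (Equiv.injective _)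

variable {P} in
/-- The homomorphism `ξ : Γ_C → P(R^∨) / Q(R^∨)`. -/
def Base.xi (b : P.Base) : b.alcoveStabilizer →* Multiplicative P.CoweightQuotient :=
  P.extendedWeylToQuotient.comp b.alcoveStabilizer.subtype

variable {P} in
open Classical in
/-- The homomorphism `ψ : P(R^∨) / Q(R^∨) → W` attached to a base: the composition of `ξ⁻¹` with
the projection `W_e → W`. For a reduced (crystallographic, finite) root system `ξ` is always an
isomorphism, because the affine Weyl group permutes the alcoves simply transitively, so the second
branch of the definition does not occur. -/
def Base.psi (b : P.Base) : Multiplicative P.CoweightQuotient →* P.weylGroup :=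
  if hb : Function.Bijective b.xi then
    (SemidirectProduct.rightHom.comp b.alcoveStabilizer.subtype).comp
      (MulEquiv.ofBijective b.xi hb).symm.toMonoidHom
  else 1

/-- The group of complex points of the torus `T = Spec ℂ[P(R)]` with character lattice `P(R)`,
that is, the group of homomorphisms from `P(R)` to `ℂˣ`. -/
abbrev Torus : Type _ := Multiplicative P.weightLattice →* ℂˣ

/-- The value `l(u)` of the character `l ∈ P(R)` at the point `u ∈ T` is `u (ofAdd l)`; the Weyl
group acts on `T` by `l(w u) = (w⁻¹ l)(u)`. -/
instance torusMulAction : MulAction P.weylGroup P.Torus where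
  smul w u :=
    { toFun l := u (.ofAdd ⟨w⁻¹ • (l.toAdd : M), P.smul_mem_weightLattice w⁻¹ l.toAdd.2⟩)
      map_one' := by
        rw [← map_one u]
        exact congrArg u (Multiplicative.toAdd.injective (Subtype.ext (smul_zero w⁻¹)))
      map_mul' l m := by
        rw [← map_mul u]
        exact congrArg u (Multiplicative.toAdd.injective (Subtype.ext (smul_add w⁻¹ _ _))) }
  one_smul u := MonoidHom.ext fun l ↦
    congrArg u (Multiplicative.toAdd.injective (Subtype.ext (by
      change (1 : P.weylGroup)⁻¹ • (l.toAdd : M) = l.toAdd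
      rw [inv_one, one_smul])))
  mul_smul x y u := MonoidHom.ext fun l ↦
    congrArg u (Multiplicative.toAdd.injective (Subtype.ext (by
      change (x * y)⁻¹ • (l.toAdd : M) = y⁻¹ • x⁻¹ • (l.toAdd : M)
      rw [mul_inv_rev, mul_smul])))

lemma weylGroup_smul_torus_apply (w : P.weylGroup) (u : P.Torus) (l : P.weightLattice) :
    (w • u) (.ofAdd l) = u (.ofAdd ⟨w⁻¹ • (l : M), P.smul_mem_weightLattice w⁻¹ l.2⟩) := rfl

variable {P} in
/-- A point of the torus is regular if its stabilizer in the Weyl group is trivial. -/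
def IsRegular (u : P.Torus) : Prop := MulAction.stabilizer P.weylGroup u = ⊥

/-- The point `x_μ` of the torus: `l(x_μ) = exp(-2π √-1 ⟨l, μ⟩)` for `l ∈ P(R)`. -/
def xPoint (m : P.coweightLattice) : P.Torus where
  toFun l := Units.mk0
    (Complex.exp (-2 * Real.pi * Complex.I * (P.toLinearMap (l.toAdd : M) (m : N) : ℝ)))
    (Complex.exp_ne_zero _)
  map_one' := by ext; simp
  map_mul' x y := by
    ext
    simp [mul_add, Complex.exp_add]

end RootPairing

end

/-!
Every point `u` of the torus has a logarithm `z = v + √-1 y` with `v, y ∈ V^*`: it is the point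
`l ↦ exp (2π √-1 ⟨l, z⟩)`, where `y` is determined by `u` and `v` is determined modulo `Q(R^∨)`
(`exists_eq_torusPoint`, `torusPoint_eq_iff`). In these terms `h u = x_μ u` says that `h y = y` and
that some `g = t_m h ∈ W_e` with `m ∈ μ + Q(R^∨)` fixes `v`, and `u` is regular when no nontrivial
element of the affine Weyl group `W_a = Q(R^∨) ⋊ W` fixes `z`.

If `u` is regular and `h u = x_μ u`, then every affine root hyperplane through `v` is transverse to
`y`, so `v + ε y` lies on no affine root hyperplane for suitable real `ε`; this point is still fixed
by `g`. The affine Weyl group moves it into the fundamental alcove `C`, and the corresponding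
conjugate of `g` fixes a point of `C`, hence lies in `Γ_C`. It has the same class in
`P(R^∨) / Q(R^∨)` as `g`, and so its image in `W`, a conjugate of `h`, is `ψ` of the class of `μ`.
Conversely an element of `Γ_C` has finite order and fixes a point of the convex set `C`, whose
exponential is regular because `W_a` acts freely on the alcoves.

The argument rests on the simple transitivity of `W_a` on the alcoves, which also makes `ξ`
bijective.
* Transitivity (`exists_extendedWeylAction_mem_fundamentalAlcove`): a point of a `W_a`-orbit at
  minimal distance from a point of `C` is not separated from it by any affine root hyperplane.
* Freeness (`eq_one_of_mem_alcoveStabilizer_of_mem_ker`): if `t_q w`, with `q ∈ Q(R^∨)`, maps `C`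
  to itself, then `q` takes only the values `-1, 0, 1` on roots, which forces `q = 0`
  (`eq_zero_of_mem_corootLattice`). So `w` permutes the positive roots, and `w = 1` by the exchange
  condition (`weylGroup_eq_one_of_forall_isPos`).
-/

noncomputable section

namespace RootPairing

variable {ι M N : Type*} [AddCommGroup M] [Module ℝ M] [AddCommGroup N] [Module ℝ N]
  {P : RootPairing ι ℝ M N}

/-! ### The Weyl group as a permutation group of the roots -/

lemma root_weylCoweightRep (w : P.weylGroup) (i : ι) (v : N) :
    P.toLinearMap (P.root i) (P.weylCoweightRep w v) =
      P.toLinearMap (P.root (P.weylGroupToPerm w⁻¹ i)) v := by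
  rw [weylCoweightRep_pairing, weylGroup_apply_root]

lemma root_weylGroupToPerm_weylCoweightRep (w : P.weylGroup) (i : ι) (v : N) :
    P.toLinearMap (P.root (P.weylGroupToPerm w i)) (P.weylCoweightRep w v) =
      P.toLinearMap (P.root i) v := by
  rw [root_weylCoweightRep, ← Equiv.Perm.mul_apply, ← map_mul, inv_mul_cancel, map_one,
    Equiv.Perm.one_apply]

lemma eq_zero_of_forall_root_eq_zero [P.IsRootSystem] {v : N}
    (h : ∀ i, P.toLinearMap (P.root i) v = 0) : v = 0 := by
  apply P.toLinearMap.flip.toPerfPair.injective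
  rw [map_zero]
  refine LinearMap.ext_on_range (v := P.root) IsRootSystem.span_root_eq_top fun i ↦ ?_
  simpa using h i

lemma weylGroup_eq_of_smul {w w' : P.weylGroup} (h : ∀ x : M, w • x = w' • x) : w = w' :=
  Subtype.ext <| Equiv.weightHom_injective P <| LinearEquiv.ext h

lemma weylGroupToPerm_injective [P.IsRootSystem] : Function.Injective P.weylGroupToPerm := by
  intro w w' h
  refine Subtype.ext <| Equiv.weightHom_injective P <| LinearEquiv.toLinearMap_injective <|
    LinearMap.ext_on_range (v := P.root) IsRootSystem.span_root_eq_top fun i ↦ ?_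
  change w • P.root i = w' • P.root i
  rw [weylGroup_apply_root, weylGroup_apply_root, h]

instance finite_weylGroup [Finite ι] [P.IsRootSystem] : Finite P.weylGroup :=
  Finite.of_injective _ weylGroupToPerm_injective

lemma weylGroupToPerm_ofIdx (i j : ι) :
    P.weylGroupToPerm (weylGroup.ofIdx P i) j = P.reflectionPerm i j := rfl

lemma ofIdx_mul_self (i : ι) : weylGroup.ofIdx P i * weylGroup.ofIdx P i = 1 :=
  weylGroup_eq_of_smul fun x ↦ by
    rw [mul_smul, one_smul]
    exact P.reflection_same i x

lemma ofIdx_weylGroupToPerm (w : P.weylGroup) (i : ι) :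
    weylGroup.ofIdx P (P.weylGroupToPerm w i) = w * weylGroup.ofIdx P i * w⁻¹ := by
  obtain ⟨w, hw⟩ := w
  induction hw using weylGroup.induction generalizing i with
  | one =>
    change weylGroup.ofIdx P i = 1 * weylGroup.ofIdx P i * 1⁻¹
    simp
  | mul x y hx hy ihx ihy =>
    have hxy : (⟨x * y, mul_mem hx hy⟩ : P.weylGroup) =
        (⟨x, hx⟩ : P.weylGroup) * (⟨y, hy⟩ : P.weylGroup) := rfl
    rw [hxy, map_mul, Equiv.Perm.mul_apply, ihx, ihy, mul_inv_rev]
    simp only [mul_assoc]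
  | mem j =>
    change weylGroup.ofIdx P (P.reflectionPerm j i) =
      weylGroup.ofIdx P j * weylGroup.ofIdx P i * (weylGroup.ofIdx P j)⁻¹
    rw [inv_eq_of_mul_eq_one_left (ofIdx_mul_self j)]
    refine weylGroup_eq_of_smul fun x ↦ ?_
    rw [mul_smul, mul_smul]
    change P.reflection _ x = P.reflection j (P.reflection i (P.reflection j x))
    rw [reflection_reflectionPerm]
    rfl

lemma ofIdx_ne_one (i : ι) : weylGroup.ofIdx P i ≠ 1 := by
  intro h
  have h1 : P.reflection i (P.root i) = P.root i := by
    change weylGroup.ofIdx P i • P.root i = _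
    rw [h, one_smul]
  rw [reflection_apply_self] at h1
  have h2 := congrArg (fun x ↦ P.toLinearMap x (P.coroot i)) h1
  simp only [map_neg, LinearMap.neg_apply, root_coroot_two] at h2
  norm_num at h2

/-! ### Simple transitivity on chambers -/

/-- The simple reflections generate the Weyl group. -/
lemma exists_word_eq [Finite ι] [P.IsCrystallographic] [P.IsReduced] (b : P.Base)
    (w : P.weylGroup) :
    ∃ L : List ι, (∀ i ∈ L, i ∈ b.support) ∧ w = (L.map (weylGroup.ofIdx P)).prod := by
  obtain ⟨w, hw⟩ := w
  induction hw using weylGroup.induction with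
  | one => exact ⟨[], by simp, rfl⟩
  | mul x y hx hy ihx ihy =>
    obtain ⟨L, hL, hx'⟩ := ihx
    obtain ⟨K, hK, hy'⟩ := ihy
    refine ⟨L ++ K, fun i hi ↦ (List.mem_append.1 hi).elim (hL i) (hK i), ?_⟩
    rw [List.map_append, List.prod_append, ← hx', ← hy']
    rfl
  | mem i =>
    change ∃ L : List ι, (∀ i ∈ L, i ∈ b.support) ∧
      weylGroup.ofIdx P i = (L.map (weylGroup.ofIdx P)).prod
    refine b.induction_reflect (p := fun i ↦ ∃ L : List ι, (∀ i ∈ L, i ∈ b.support) ∧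
        weylGroup.ofIdx P i = (L.map (weylGroup.ofIdx P)).prod) i (fun i ⟨L, hL, h⟩ ↦ ⟨L, hL, ?_⟩)
      (fun i hi ↦ ⟨[i], by simpa, by simp⟩) (fun i j ⟨L, hL, h⟩ hj ↦ ⟨j :: (L ++ [j]), ?_, ?_⟩)
    · rw [← h, ← weylGroupToPerm_ofIdx, ofIdx_weylGroupToPerm]
      simp
    · intro k hk
      simp only [List.mem_cons, List.mem_append, List.not_mem_nil, or_false] at hk
      rcases hk with rfl | hk | rfl
      exacts [hj, hL k hk, hj]
    · rw [← weylGroupToPerm_ofIdx, ofIdx_weylGroupToPerm, h,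
        inv_eq_of_mul_eq_one_left (ofIdx_mul_self j)]
      simp [mul_assoc]

section

variable [Finite ι] [P.IsCrystallographic] [P.IsReduced]

/-- The exchange condition: if the product of a word of simple reflections sends the simple root
`αᵢ` to a negative root, then multiplying by `sᵢ` on the right deletes a letter of the word. -/
lemma exists_word_mul_ofIdx_eq (b : P.Base) {i : ι} (hi : i ∈ b.support) (L : List ι)
    (hL : ∀ j ∈ L, j ∈ b.support)
    (hneg : ¬ b.IsPos (P.weylGroupToPerm (L.map (weylGroup.ofIdx P)).prod i)) :
    ∃ K : List ι, (∀ j ∈ K, j ∈ b.support) ∧ K.length + 1 = L.length ∧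
      (L.map (weylGroup.ofIdx P)).prod * weylGroup.ofIdx P i =
        (K.map (weylGroup.ofIdx P)).prod := by
  induction L with
  | nil => exact absurd (Base.isPos_of_mem_support hi) hneg
  | cons j L ih =>
    have hj : j ∈ b.support := hL j (by simp)
    have hL' : ∀ k ∈ L, k ∈ b.support := fun k hk ↦ hL k (by simp [hk])
    by_cases hpos : b.IsPos (P.weylGroupToPerm (L.map (weylGroup.ofIdx P)).prod i)
    · -- the only positive root made negative by `sⱼ` is `αⱼ`
      have hij : P.weylGroupToPerm (L.map (weylGroup.ofIdx P)).prod i = j := by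
        by_contra hne
        refine hneg ?_
        rw [List.map_cons, List.prod_cons, map_mul, Equiv.Perm.mul_apply]
        exact hpos.reflectionPerm hj hne
      have h := ofIdx_weylGroupToPerm (L.map (weylGroup.ofIdx P)).prod i
      rw [hij] at h
      refine ⟨L, hL', by simp, ?_⟩
      rw [List.map_cons, List.prod_cons, h]
      simp only [mul_assoc, inv_mul_cancel_left, ofIdx_mul_self, mul_one]
    · obtain ⟨K, hK, hlen, h⟩ := ih hL' hpos
      refine ⟨j :: K, ?_, by simp [hlen], ?_⟩
      · intro k hk
        rcases List.mem_cons.1 hk with rfl | hk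
        exacts [hj, hK k hk]
      · rw [List.map_cons, List.prod_cons, mul_assoc, h, List.map_cons, List.prod_cons]

/-- An element of the Weyl group that permutes the positive roots is trivial. -/
lemma weylGroup_eq_one_of_forall_isPos (b : P.Base) (w : P.weylGroup)
    (hw : ∀ i, b.IsPos i → b.IsPos (P.weylGroupToPerm w i)) : w = 1 := by
  obtain ⟨L, hL, h⟩ := exists_word_eq b w
  generalize hn : L.length = n
  induction n using Nat.strong_induction_on generalizing L with
  | _ n ih =>
    rcases List.eq_nil_or_concat L with rfl | ⟨K, i, rfl⟩
    · simpa using h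
    · rw [List.concat_eq_append] at h hL hn
      have hi : i ∈ b.support := hL i (by simp)
      have hK : ∀ k ∈ K, k ∈ b.support := fun k hk ↦ hL k (by simp [hk])
      rw [List.map_append, List.prod_append, List.map_singleton, List.prod_singleton] at h
      have hneg : ¬ b.IsPos (P.weylGroupToPerm (K.map (weylGroup.ofIdx P)).prod i) := by
        have h1 := hw i (Base.isPos_of_mem_support hi)
        let := P.indexNeg
        have h2 : P.weylGroupToPerm w i =
            -(P.weylGroupToPerm (K.map (weylGroup.ofIdx P)).prod i) := by
          apply P.root.injective
          rw [h, map_mul, Equiv.Perm.mul_apply, weylGroupToPerm_ofIdx, indexNeg_neg,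
            ← weylGroup_apply_root, root_reflectionPerm, root_reflectionPerm,
            reflection_apply_self, reflection_apply_self, smul_neg, weylGroup_apply_root]
        rw [h2, Base.IsPos.neg_iff_not] at h1
        exact h1
      obtain ⟨K', hK', hlen, h'⟩ := exists_word_mul_ofIdx_eq b hi K hK hneg
      refine ih K'.length ?_ K' hK' (h.trans h') rfl
      rw [← hn, List.length_append]
      lia

end

/-! ### The affine Weyl group -/

lemma mem_ker_extendedWeylToQuotient {g : P.ExtendedWeylGroup} :
    g ∈ P.extendedWeylToQuotient.ker ↔ (g.left.toAdd : N) ∈ P.corootLattice := by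
  rw [MonoidHom.mem_ker]
  exact QuotientAddGroup.eq_zero_iff g.left.toAdd

lemma root_extendedWeylAction (g : P.ExtendedWeylGroup) (i : ι) (v : N) :
    P.toLinearMap (P.root i) (P.extendedWeylAction g v) =
      P.toLinearMap (P.root i) (g.left.toAdd : N) +
        P.toLinearMap (P.root (P.weylGroupToPerm g.right⁻¹ i)) v := by
  rw [extendedWeylAction_apply, map_add, root_weylCoweightRep]

lemma extendedWeylGroup_eq_one {g : P.ExtendedWeylGroup} (hl : (g.left.toAdd : N) = 0)
    (hr : g.right = 1) : g = 1 :=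
  SemidirectProduct.ext (Multiplicative.toAdd.injective (Subtype.ext hl)) hr

lemma corootLattice_le_coweightLattice [P.IsCrystallographic] :
    P.corootLattice ≤ P.coweightLattice := by
  refine (AddSubgroup.closure_le _).2 ?_
  rintro _ ⟨j, rfl⟩ i
  exact ⟨P.pairingIn ℤ i j, (P.algebraMap_pairingIn ℤ i j).symm⟩

lemma coroot_mem_corootLattice (i : ι) : P.coroot i ∈ P.corootLattice :=
  AddSubgroup.subset_closure (Set.mem_range_self i)

/-- The reflection in the affine hyperplane `αᵢ = n`, as an element of the affine Weyl group. -/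
def affineReflection [P.IsCrystallographic] (i : ι) (n : ℤ) : P.ExtendedWeylGroup :=
  ⟨.ofAdd ⟨n • P.coroot i,
    corootLattice_le_coweightLattice (zsmul_mem (coroot_mem_corootLattice i) n)⟩,
    weylGroup.ofIdx P i⟩

lemma affineReflection_mem_ker [P.IsCrystallographic] (i : ι) (n : ℤ) :
    P.affineReflection i n ∈ P.extendedWeylToQuotient.ker :=
  mem_ker_extendedWeylToQuotient.2 (zsmul_mem (coroot_mem_corootLattice i) n)

lemma extendedWeylAction_affineReflection [P.IsCrystallographic] (i : ι) (n : ℤ) (v : N) :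
    P.extendedWeylAction (P.affineReflection i n) v =
      v - (P.toLinearMap (P.root i) v - n) • P.coroot i := by
  rw [extendedWeylAction_apply]
  change n • P.coroot i + P.weylCoweightRep (weylGroup.ofIdx P i) v = _
  rw [weylCoweightRep_ofIdx, sub_smul, Int.cast_smul_eq_zsmul]
  abel

/-! ### The invariant inner product on the coweight space -/

section Form

variable [Fintype ι]

lemma two_mul_corootForm_coroot (i : ι) (v : N) :
    2 * P.CorootForm v (P.coroot i) =
      P.CorootForm (P.coroot i) (P.coroot i) * P.toLinearMap (P.root i) v := by
  have h := congrArg (fun x ↦ P.toLinearMap x v) (P.corootForm_self_smul_root i)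
  simp only [map_smul, LinearMap.smul_apply, map_nsmul, toLinearMap_apply_CoPolarization,
    smul_eq_mul, nsmul_eq_mul, Nat.cast_ofNat] at h
  rw [h]
  simp only [corootForm_apply_apply, mul_comm]

lemma corootForm_self_nonneg (v : N) : 0 ≤ P.CorootForm v v := by
  rw [corootForm_apply_apply]
  exact Finset.sum_nonneg fun i _ ↦ mul_self_nonneg _

lemma sq_root_le_corootForm (i : ι) (v : N) :
    P.toLinearMap (P.root i) v ^ 2 ≤ P.CorootForm v v := by
  rw [corootForm_apply_apply, sq]
  exact Finset.single_le_sum (f := fun i ↦ P.root' i v * P.root' i v)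
    (fun i _ ↦ mul_self_nonneg _) (Finset.mem_univ i)

lemma corootForm_self_pos [P.IsRootSystem] {v : N} (hv : v ≠ 0) : 0 < P.CorootForm v v := by
  refine (corootForm_self_nonneg v).lt_of_ne fun h ↦ hv <| eq_zero_of_forall_root_eq_zero
    fun i ↦ pow_eq_zero_iff (two_ne_zero) |>.1 <|
      le_antisymm ((sq_root_le_corootForm i v).trans h.symm.le) (sq_nonneg _)

lemma corootForm_coroot_pos (i : ι) : 0 < P.CorootForm (P.coroot i) (P.coroot i) := by
  have := sq_root_le_corootForm (P := P) i (P.coroot i)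
  rw [root_coroot_two] at this
  linarith

/-- How an affine reflection changes the square of the distance to a point `c`. -/
lemma corootForm_affineReflection [P.IsCrystallographic] (i : ι) (n : ℤ) (v c : N) :
    P.CorootForm (P.extendedWeylAction (P.affineReflection i n) v - c)
        (P.extendedWeylAction (P.affineReflection i n) v - c) =
      P.CorootForm (v - c) (v - c) + P.CorootForm (P.coroot i) (P.coroot i) *
        ((P.toLinearMap (P.root i) v - n) * (P.toLinearMap (P.root i) c - n)) := by
  have h := two_mul_corootForm_coroot (P := P) i (v - c)
  have hs : P.CorootForm (P.coroot i) (v - c) = P.CorootForm (v - c) (P.coroot i) := by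
    simp only [corootForm_apply_apply, mul_comm]
  rw [extendedWeylAction_affineReflection, sub_right_comm]
  rw [map_sub (P.toLinearMap (P.root i))] at h
  generalize P.toLinearMap (P.root i) v = a at *
  generalize v - c = x at *
  simp only [map_sub, map_smul, LinearMap.sub_apply, LinearMap.smul_apply, smul_eq_mul, hs]
  linear_combination (-(a - n)) * h

end Form

/-! ### Small elements of the coroot lattice -/

lemma exists_list_of_mem_corootLattice {q : N} (hq : q ∈ P.corootLattice) :
    ∃ L : List ι, q = (L.map P.coroot).sum := by
  induction hq using AddSubgroup.closure_induction with
  | mem x hx =>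
    obtain ⟨i, rfl⟩ := hx
    exact ⟨[i], by simp⟩
  | zero => exact ⟨[], rfl⟩
  | add x y _ _ hx hy =>
    obtain ⟨L, rfl⟩ := hx
    obtain ⟨K, rfl⟩ := hy
    exact ⟨L ++ K, by simp⟩
  | neg x _ hx =>
    obtain ⟨L, rfl⟩ := hx
    refine ⟨L.map fun i ↦ P.reflectionPerm i i, ?_⟩
    clear * -
    induction L with
    | nil => simp
    | cons i L ih =>
      rw [List.map_cons, List.sum_cons, neg_add, ih]
      simp [coroot_reflectionPerm]

/-- A nonzero element of the coroot lattice takes a value of absolute value at least `2` on some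
root; in other words, minuscule coweights do not lie in the coroot lattice. Written as a sum of
coroots, a counterexample `q` takes the value `1` at the root of one of the summands `β^∨`, and
`q - β^∨ = s_β q` is again a counterexample, with fewer summands. -/
lemma eq_zero_of_mem_corootLattice [Finite ι] [P.IsRootSystem] [P.IsCrystallographic] {q : N}
    (hq : q ∈ P.corootLattice) (h : ∀ i, P.toLinearMap (P.root i) q ≤ 1) : q = 0 := by
  classical
  have := Fintype.ofFinite ι
  obtain ⟨L, hL⟩ := exists_list_of_mem_corootLattice hq
  generalize hn : L.length = n
  induction n generalizing q L with
  | zero => rw [hL, List.length_eq_zero_iff.1 hn]; rfl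
  | succ n ih =>
    by_contra hq0
    obtain ⟨j, hj, hjq⟩ : ∃ j ∈ L, 0 < P.CorootForm q (P.coroot j) := by
      by_contra! hneg
      have h1 : P.CorootForm q q = (L.map fun j ↦ P.CorootForm q (P.coroot j)).sum := by
        conv_lhs => enter [2]; rw [hL]
        rw [map_list_sum, List.map_map]
        rfl
      refine (corootForm_self_pos hq0).not_ge (h1.trans_le ?_)
      refine (List.sum_le_card_nsmul _ 0 fun x hx ↦ ?_).trans_eq (smul_zero _)
      obtain ⟨j, hj, rfl⟩ := List.mem_map.1 hx
      exact hneg j hj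
    have hjq' : P.toLinearMap (P.root j) q = 1 := by
      obtain ⟨m, hm⟩ := corootLattice_le_coweightLattice hq j
      change P.toLinearMap (P.root j) q = m at hm
      have h1 : 0 < P.toLinearMap (P.root j) q := by
        have := two_mul_corootForm_coroot (P := P) j q
        exact pos_of_mul_pos_right (by linarith) (corootForm_coroot_pos (P := P) j).le
      have h2 := h j
      rw [hm] at h1 h2 ⊢
      norm_cast at *
      lia
    have hs : P.weylCoweightRep (weylGroup.ofIdx P j) q = q - P.coroot j := by
      rw [weylCoweightRep_ofIdx, hjq', one_smul]
    have h0 : q - P.coroot j = 0 := by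
      refine ih (sub_mem hq (coroot_mem_corootLattice j)) (fun i ↦ ?_) (L.erase j) ?_ ?_
      · rw [← hs, root_weylCoweightRep]
        exact h _
      · rw [hL, ← ((List.perm_cons_erase hj).map P.coroot).sum_eq.symm]
        simp
      · rw [List.length_erase_of_mem hj, hn, Nat.add_sub_cancel]
    have h2 := P.root_coroot_two j
    rw [← sub_eq_zero.1 h0, hjq'] at h2
    norm_num at h2

/-! ### The fundamental alcove -/

/-- The vector is `ρ^∨`, on which every simple root takes the value `1`. -/
lemma exists_forall_root_eq_height [P.IsRootSystem] (b : P.Base) :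
    ∃ v : N, ∀ i, P.toLinearMap (P.root i) v = b.height i := by
  let f : Module.Dual ℝ M := b.toWeightBasis.constr ℝ fun _ ↦ 1
  refine ⟨P.toLinearMap.flip.toPerfPair.symm f, fun i ↦ ?_⟩
  rw [LinearMap.apply_toPerfPair_flip]
  obtain ⟨c, -, -, hc⟩ := b.exists_root_eq_sum_int i
  rw [Base.height_eq_sum hc, hc, map_sum, Int.cast_sum]
  refine Finset.sum_congr rfl fun j hj ↦ ?_
  have h1 : f (P.root j) = 1 := by
    have := b.toWeightBasis.constr_basis ℝ (fun _ ↦ (1 : ℝ)) ⟨j, hj⟩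
    rwa [Base.toWeightBasis_apply] at this
  rw [map_zsmul, h1]
  simp

lemma fundamentalAlcove_nonempty [Finite ι] [P.IsRootSystem] (b : P.Base) :
    b.fundamentalAlcove.Nonempty := by
  obtain ⟨v, hv⟩ := exists_forall_root_eq_height b
  obtain ⟨K, hK⟩ := (Set.finite_range b.height).bddAbove
  -- `v` takes every positive root to its height, so dividing by more than all heights suffices
  refine ⟨(|(K : ℝ)| + 1)⁻¹ • v, fun i hi ↦ ?_⟩
  have hpos : (0 : ℝ) < b.height i := by exact_mod_cast hi
  have hle : (b.height i : ℝ) ≤ |(K : ℝ)| :=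
    (Int.cast_le.2 (hK (Set.mem_range_self i))).trans (le_abs_self _)
  have hd : (0 : ℝ) < |(K : ℝ)| + 1 := by positivity
  rw [map_smul, hv, smul_eq_mul]
  refine ⟨by positivity, ?_⟩
  rw [inv_mul_lt_one₀ hd]
  linarith

lemma root_mem_Ioo_of_not_isPos {b : P.Base} {c : N} (hc : c ∈ b.fundamentalAlcove) {i : ι}
    (hi : ¬ b.IsPos i) :
    P.toLinearMap (P.root i) c ∈ Set.Ioo (-1 : ℝ) 0 := by
  let := P.indexNeg
  have h := hc (-i) ((Base.IsPos.neg_iff_not b i).2 hi)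
  rw [indexNeg_neg, root_reflectionPerm, reflection_apply_self, map_neg, LinearMap.neg_apply] at h
  exact ⟨by linarith, by linarith⟩

lemma abs_root_lt_one {b : P.Base} {c : N} (hc : c ∈ b.fundamentalAlcove) (i : ι) :
    |P.toLinearMap (P.root i) c| < 1 := by
  rw [abs_lt]
  by_cases hi : b.IsPos i
  · have := hc i hi
    exact ⟨by linarith, this.2⟩
  · have := root_mem_Ioo_of_not_isPos hc hi
    exact ⟨this.1, by linarith [this.2]⟩

lemma root_ne_intCast_of_mem_fundamentalAlcove {b : P.Base} {c : N}
    (hc : c ∈ b.fundamentalAlcove) (i : ι) (n : ℤ) : P.toLinearMap (P.root i) c ≠ n := by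
  intro h
  by_cases hi : b.IsPos i
  · have := hc i hi
    rw [h] at this
    norm_cast at this
    lia
  · have := root_mem_Ioo_of_not_isPos hc hi
    rw [h, Set.mem_Ioo] at this
    norm_cast at this
    lia

/-- `W_e` preserves the complement of the affine root hyperplanes. -/
lemma root_extendedWeylAction_ne_intCast {v : N}
    (hv : ∀ i (n : ℤ), P.toLinearMap (P.root i) v ≠ n) (g : P.ExtendedWeylGroup) (i : ι) (n : ℤ) :
    P.toLinearMap (P.root i) (P.extendedWeylAction g v) ≠ n := by
  obtain ⟨m, hm⟩ := P.mem_coweightLattice.1 g.left.toAdd.2 i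
  rw [root_extendedWeylAction, hm]
  intro h
  refine hv (P.weylGroupToPerm g.right⁻¹ i) (n - m) ?_
  push_cast
  linarith

/-- An element of `W_e` that sends one point of the alcove into the alcove stabilizes it, since
`W_e` permutes the affine root hyperplanes. -/
lemma extendedWeylAction_mem_fundamentalAlcove {b : P.Base} {g : P.ExtendedWeylGroup} {c x : N}
    (hc : c ∈ b.fundamentalAlcove) (hgc : P.extendedWeylAction g c ∈ b.fundamentalAlcove)
    (hx : x ∈ b.fundamentalAlcove) : P.extendedWeylAction g x ∈ b.fundamentalAlcove := by
  intro i hi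
  have h := hgc i hi
  obtain ⟨n, hn⟩ := P.mem_coweightLattice.1 g.left.toAdd.2 i
  rw [root_extendedWeylAction, hn] at h ⊢
  by_cases hj : b.IsPos (P.weylGroupToPerm g.right⁻¹ i)
  · have hcj := hc _ hj
    have hxj := hx _ hj
    have h1 : n < 1 := by exact_mod_cast (by linarith : (n : ℝ) < 1)
    have h2 : -1 < n := by exact_mod_cast (by linarith : (-1 : ℝ) < n)
    obtain rfl : n = 0 := by lia
    simpa using hxj
  · have hcj := root_mem_Ioo_of_not_isPos hc hj
    have hxj := root_mem_Ioo_of_not_isPos hx hj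
    have h1 : n < 2 := by exact_mod_cast (by linarith [hcj.1] : (n : ℝ) < 2)
    have h2 : 0 < n := by exact_mod_cast (by linarith [hcj.2] : (0 : ℝ) < n)
    obtain rfl : n = 1 := by lia
    push_cast
    exact ⟨by linarith [hxj.1], by linarith [hxj.2]⟩

lemma mem_alcoveStabilizer_of_mem {b : P.Base} {g : P.ExtendedWeylGroup} {c : N}
    (hc : c ∈ b.fundamentalAlcove) (hgc : P.extendedWeylAction g c ∈ b.fundamentalAlcove) :
    g ∈ b.alcoveStabilizer := by
  refine Set.Subset.antisymm ?_ fun x hx ↦ ?_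
  · rintro _ ⟨x, hx, rfl⟩
    exact extendedWeylAction_mem_fundamentalAlcove hc hgc hx
  · refine ⟨P.extendedWeylAction g⁻¹ x, ?_, by
      rw [← Equiv.Perm.mul_apply, ← map_mul, mul_inv_cancel, map_one, Equiv.Perm.one_apply]⟩
    refine extendedWeylAction_mem_fundamentalAlcove hgc ?_ hx
    rwa [← Equiv.Perm.mul_apply, ← map_mul, inv_mul_cancel, map_one, Equiv.Perm.one_apply]

lemma extendedWeylAction_mem_of_mem_alcoveStabilizer {b : P.Base} {g : P.ExtendedWeylGroup}
    (hg : g ∈ b.alcoveStabilizer) {c : N} (hc : c ∈ b.fundamentalAlcove) :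
    P.extendedWeylAction g c ∈ b.fundamentalAlcove :=
  (show P.extendedWeylAction g '' _ = _ from hg) ▸ Set.mem_image_of_mem _ hc

/-! ### Simple transitivity on alcoves -/

/-- Every orbit of the affine Weyl group in the complement of the affine root hyperplanes meets
the fundamental alcove `C`: a point of the orbit closest to a fixed point of `C` lies in `C`, since
otherwise a reflection in a hyperplane separating the two points would bring it closer. -/
lemma exists_extendedWeylAction_mem_fundamentalAlcove [Finite ι] [P.IsRootSystem]
    [P.IsCrystallographic] (b : P.Base) {v : N}
    (hv : ∀ i (n : ℤ), P.toLinearMap (P.root i) v ≠ n) :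
    ∃ a ∈ P.extendedWeylToQuotient.ker, P.extendedWeylAction a v ∈ b.fundamentalAlcove := by
  have := Fintype.ofFinite ι
  obtain ⟨c, hc⟩ := fundamentalAlcove_nonempty b
  let f (a : P.ExtendedWeylGroup) : ℝ :=
    P.CorootForm (P.extendedWeylAction a v - c) (P.extendedWeylAction a v - c)
  -- only finitely many elements of the orbit matter for the minimum: `a` is determined by its
  -- linear part and the integers `αᵢ(q)`, where `q` is its translation part, and these integers
  -- are bounded in terms of the distance from `a v` to `c`
  let S : Set P.ExtendedWeylGroup := {a | a ∈ P.extendedWeylToQuotient.ker ∧ f a ≤ f 1}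
  have hS : S.Finite := by
    let key (a : P.ExtendedWeylGroup) : P.weylGroup × (ι → ℝ) :=
      (a.right, fun i ↦ P.toLinearMap (P.root i) (a.left.toAdd : N))
    let R : ℝ := f 1 + 1 + ∑ i, |P.toLinearMap (P.root i) c| + ∑ i, |P.toLinearMap (P.root i) v|
    let T : Set (P.weylGroup × (ι → ℝ)) :=
      Set.univ ×ˢ Set.univ.pi fun _ ↦ (Int.cast '' Set.Icc (-⌈R⌉) ⌈R⌉ : Set ℝ)
    have hT : T.Finite :=
      Set.finite_univ.prod (Set.Finite.pi fun _ ↦ (Set.finite_Icc _ _).image _)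
    refine Set.Finite.of_finite_image (f := key) (hT.subset ?_) ?_
    · rintro _ ⟨a, ha, rfl⟩
      refine ⟨Set.mem_univ _, fun i _ ↦ ?_⟩
      obtain ⟨n, hn⟩ := P.mem_coweightLattice.1 a.left.toAdd.2 i
      refine ⟨n, ?_, hn.symm⟩
      have h1 : P.toLinearMap (P.root i) (P.extendedWeylAction a v - c) ^ 2 ≤ f 1 :=
        (sq_root_le_corootForm i _).trans ha.2
      have h2 : |P.toLinearMap (P.root i) (P.extendedWeylAction a v - c)| ≤ f 1 + 1 := by
        rw [← sq_abs] at h1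
        nlinarith [sq_nonneg (|P.toLinearMap (P.root i) (P.extendedWeylAction a v - c)| - 1)]
      have h3 : |P.toLinearMap (P.root i) c| ≤ ∑ i, |P.toLinearMap (P.root i) c| :=
        Finset.single_le_sum (f := fun i ↦ |P.toLinearMap (P.root i) c|)
          (fun _ _ ↦ abs_nonneg _) (Finset.mem_univ i)
      have h4 : |P.toLinearMap (P.root (P.weylGroupToPerm a.right⁻¹ i)) v| ≤
          ∑ i, |P.toLinearMap (P.root i) v| :=
        Finset.single_le_sum (f := fun i ↦ |P.toLinearMap (P.root i) v|)
          (fun _ _ ↦ abs_nonneg _) (Finset.mem_univ _)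
      rw [map_sub, root_extendedWeylAction, hn] at h2
      rw [abs_le] at h2 h3 h4
      have h5 : (n : ℝ) ≤ ⌈R⌉ := le_trans (by simp only [R]; linarith) (Int.le_ceil R)
      have h6 : (-n : ℝ) ≤ ⌈R⌉ := le_trans (by simp only [R]; linarith) (Int.le_ceil R)
      rw [Set.mem_Icc]
      norm_cast at h5 h6
      exact ⟨by lia, h5⟩
    · intro x _ y _ hxy
      refine SemidirectProduct.ext (Multiplicative.toAdd.injective (Subtype.ext ?_))
        (congrArg Prod.fst hxy)
      rw [← sub_eq_zero]
      refine eq_zero_of_forall_root_eq_zero (P := P) fun i ↦ ?_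
      rw [map_sub, sub_eq_zero]
      exact congrFun (congrArg Prod.snd hxy) i
  obtain ⟨a, ha, hmin⟩ := Set.exists_min_image S f hS ⟨1, one_mem _, le_rfl⟩
  -- no affine root hyperplane strictly separates `a v` from `c`
  have hrefl (i : ι) (n : ℤ) :
      0 ≤ (P.toLinearMap (P.root i) (P.extendedWeylAction a v) - n) *
        (P.toLinearMap (P.root i) c - n) := by
    by_contra! hneg
    have h1 : f (P.affineReflection i n * a) < f a := by
      simp only [f, map_mul, Equiv.Perm.mul_apply]
      rw [corootForm_affineReflection]
      linarith [mul_neg_of_pos_of_neg (corootForm_coroot_pos (P := P) i) hneg]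
    exact h1.not_ge (hmin _ ⟨mul_mem (affineReflection_mem_ker i n) ha.1, h1.le.trans ha.2⟩)
  have hne := root_extendedWeylAction_ne_intCast hv a
  refine ⟨a, ha.1, fun i hi ↦ ⟨?_, ?_⟩⟩
  · have h0 := hrefl i 0
    have h1 := hne i 0
    rw [Int.cast_zero] at h1
    rw [Int.cast_zero, sub_zero, sub_zero] at h0
    exact (nonneg_of_mul_nonneg_left h0 (hc i hi).1).lt_of_ne' h1
  · have h0 := hrefl i 1
    have h1 := hne i 1
    rw [Int.cast_one] at h0 h1
    refine lt_of_le_of_ne ?_ h1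
    by_contra! h
    exact absurd h0 (mul_neg_of_pos_of_neg (by linarith) (by linarith [(hc i hi).2])).not_ge

/-- The affine Weyl group acts freely on alcoves. -/
lemma eq_one_of_mem_alcoveStabilizer_of_mem_ker [Finite ι] [P.IsRootSystem]
    [P.IsCrystallographic] [P.IsReduced] {b : P.Base} {g : P.ExtendedWeylGroup}
    (hg : g ∈ b.alcoveStabilizer) (hg' : g ∈ P.extendedWeylToQuotient.ker) : g = 1 := by
  obtain ⟨c, hc⟩ := fundamentalAlcove_nonempty b
  have hgc := extendedWeylAction_mem_of_mem_alcoveStabilizer hg hc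
  have hl : (g.left.toAdd : N) = 0 := by
    refine eq_zero_of_mem_corootLattice (mem_ker_extendedWeylToQuotient.1 hg') fun i ↦ ?_
    obtain ⟨n, hn⟩ := P.mem_coweightLattice.1 g.left.toAdd.2 i
    have h1 := abs_root_lt_one hgc i
    have h2 := abs_root_lt_one hc (P.weylGroupToPerm g.right⁻¹ i)
    rw [root_extendedWeylAction, hn] at h1
    rw [hn]
    rw [abs_lt] at h1 h2
    have h3 : n < 2 := by exact_mod_cast (by linarith : (n : ℝ) < 2)
    exact_mod_cast (by lia : n ≤ 1)
  refine extendedWeylGroup_eq_one hl (weylGroup_eq_one_of_forall_isPos b _ fun i hi ↦ ?_)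
  by_contra hneg
  have h1 := (root_mem_Ioo_of_not_isPos hgc hneg).2
  rw [extendedWeylAction_apply, hl, zero_add, root_weylGroupToPerm_weylCoweightRep] at h1
  exact h1.not_gt (hc i hi).1

/-- Surjectivity: if `t_m` moves the alcove to another one, the affine Weyl group moves it back. -/
lemma xi_bijective [Finite ι] [P.IsRootSystem] [P.IsCrystallographic] [P.IsReduced]
    (b : P.Base) : Function.Bijective b.xi := by
  refine ⟨(injective_iff_map_eq_one _).2 fun g hg ↦
    Subtype.ext (eq_one_of_mem_alcoveStabilizer_of_mem_ker g.2 (MonoidHom.mem_ker.2 hg)),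
    fun x ↦ ?_⟩
  obtain ⟨m, hm⟩ := QuotientAddGroup.mk_surjective x.toAdd
  obtain ⟨c, hc⟩ := fundamentalAlcove_nonempty b
  let t : P.ExtendedWeylGroup := ⟨.ofAdd m, 1⟩
  obtain ⟨a, ha, hac⟩ := exists_extendedWeylAction_mem_fundamentalAlcove b
    (root_extendedWeylAction_ne_intCast (root_ne_intCast_of_mem_fundamentalAlcove hc) t)
  rw [← Equiv.Perm.mul_apply, ← map_mul] at hac
  refine ⟨⟨a * t, mem_alcoveStabilizer_of_mem hc hac⟩, ?_⟩
  change P.extendedWeylToQuotient (a * t) = x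
  rw [map_mul, MonoidHom.mem_ker.1 ha, one_mul]
  exact congrArg Multiplicative.ofAdd hm

/-! ### Elements of the stabilizer of the alcove -/

lemma exists_pow_eq_one_of_mem_alcoveStabilizer [Finite ι] [P.IsRootSystem] {b : P.Base}
    {g : P.ExtendedWeylGroup} (hg : g ∈ b.alcoveStabilizer) : ∃ n, 0 < n ∧ g ^ n = 1 := by
  obtain ⟨c, hc⟩ := fundamentalAlcove_nonempty b
  refine ⟨orderOf g.right, orderOf_pos _, ?_⟩
  have hr : (g ^ orderOf g.right).right = 1 := by
    change SemidirectProduct.rightHom (g ^ orderOf g.right) = 1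
    rw [map_pow]
    exact pow_orderOf_eq_one _
  -- the power of `g` with trivial linear part is a translation that maps `C` to itself
  have hgc := extendedWeylAction_mem_of_mem_alcoveStabilizer (pow_mem hg (orderOf g.right)) hc
  generalize g ^ orderOf g.right = k at *
  refine extendedWeylGroup_eq_one (eq_zero_of_forall_root_eq_zero (P := P) fun i ↦ ?_) hr
  obtain ⟨n, hn⟩ := P.mem_coweightLattice.1 k.left.toAdd.2 i
  have h (j : ι) : P.toLinearMap (P.root j) (P.extendedWeylAction k c) =
      P.toLinearMap (P.root j) (k.left.toAdd : N) + P.toLinearMap (P.root j) c := by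
    rw [root_extendedWeylAction, hr, inv_one, map_one, Equiv.Perm.one_apply]
  have h0 := h i
  rw [hn] at h0 ⊢
  have hn' : -1 < (n : ℝ) ∧ (n : ℝ) < 1 := by
    by_cases hi : b.IsPos i
    · have h1 := hc i hi
      have h2 := hgc i hi
      exact ⟨by linarith, by linarith⟩
    · have h1 := root_mem_Ioo_of_not_isPos hc hi
      have h2 := root_mem_Ioo_of_not_isPos hgc hi
      exact ⟨by linarith [h1.2, h2.1], by linarith [h1.1, h2.2]⟩
  norm_cast at hn' ⊢
  lia

/-- An element of `Γ_C` has finite order and `C` is convex, so it fixes the average of any of its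
orbits in `C`. -/
lemma exists_fixed_of_mem_alcoveStabilizer [Finite ι] [P.IsRootSystem] {b : P.Base}
    {g : P.ExtendedWeylGroup} (hg : g ∈ b.alcoveStabilizer) :
    ∃ v ∈ b.fundamentalAlcove, P.extendedWeylAction g v = v := by
  obtain ⟨c, hc⟩ := fundamentalAlcove_nonempty b
  obtain ⟨n, hn, hgn⟩ := exists_pow_eq_one_of_mem_alcoveStabilizer hg
  have hn0 : (0 : ℝ) < n := by exact_mod_cast hn
  let x (k : ℕ) : N := P.extendedWeylAction (g ^ k) c
  have hx (k : ℕ) : x k ∈ b.fundamentalAlcove :=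
    extendedWeylAction_mem_of_mem_alcoveStabilizer (pow_mem hg k) hc
  have hsucc (k : ℕ) : (g.left.toAdd : N) + P.weylCoweightRep g.right (x k) = x (k + 1) := by
    rw [← extendedWeylAction_apply]
    simp only [x, pow_succ', map_mul, Equiv.Perm.mul_apply]
  refine ⟨(n : ℝ)⁻¹ • ∑ k ∈ Finset.range n, x k, fun i hi ↦ ?_, ?_⟩
  · have hne : (Finset.range n).Nonempty := Finset.nonempty_range_iff.2 hn.ne'
    have h1 := Finset.sum_lt_sum_of_nonempty hne fun k _ ↦ (hx k i hi).1
    have h2 := Finset.sum_lt_sum_of_nonempty hne fun k _ ↦ (hx k i hi).2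
    rw [map_smul, map_sum, smul_eq_mul]
    simp only [Finset.sum_const_zero, Finset.sum_const, Finset.card_range, nsmul_eq_mul,
      mul_one] at h1 h2
    exact ⟨by positivity, by rwa [inv_mul_lt_one₀ hn0]⟩
  · have h1 : ∑ k ∈ Finset.range n, x (k + 1) = ∑ k ∈ Finset.range n, x k := by
      have h2 := Finset.sum_range_succ' x n
      rw [Finset.sum_range_succ] at h2
      have h3 : x n = x 0 := by simp only [x, hgn, pow_zero]
      rw [h3] at h2
      exact (add_right_cancel h2).symm
    rw [extendedWeylAction_apply, map_smul, map_sum, ← h1]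
    simp only [← hsucc, Finset.sum_add_distrib, Finset.sum_const, Finset.card_range, smul_add]
    rw [← Nat.cast_smul_eq_nsmul ℝ, smul_smul, inv_mul_cancel₀ hn0.ne', one_smul]

/-! ### Fundamental weights -/

/-- The fundamental weight dual to the simple coroot of index `i`. -/
def Base.fundamentalWeight [P.IsRootSystem] (b : P.Base) (i : b.support) : M :=
  P.toLinearMap.toPerfPair.symm (b.toCoweightBasis.coord i)

lemma fundamentalWeight_apply [P.IsRootSystem] (b : P.Base) (i : b.support) (v : N) :
    P.toLinearMap (b.fundamentalWeight i) v = b.toCoweightBasis.repr v i := by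
  rw [Base.fundamentalWeight, LinearMap.apply_symm_toPerfPair_self, Module.Basis.coord_apply]

lemma fundamentalWeight_mem_weightLattice [P.IsRootSystem] (b : P.Base) (i : b.support) :
    b.fundamentalWeight i ∈ P.weightLattice := by
  classical
  intro j
  obtain ⟨c, -, -, hc⟩ := b.flip.exists_root_eq_sum_int j
  change P.coroot j = ∑ k ∈ b.support, c k • P.coroot k at hc
  refine ⟨c i, ?_⟩
  rw [hc, map_sum, ← Finset.sum_coe_sort b.support (fun k ↦
    P.toLinearMap (b.fundamentalWeight i) (c k • P.coroot k))]
  simp only [map_zsmul, fundamentalWeight_apply, Base.toCoweightBasis_repr_coroot]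
  simp [Finsupp.single_apply]

lemma eq_sum_fundamentalWeight [P.IsRootSystem] (b : P.Base) (l : M) :
    l = ∑ i : b.support, P.toLinearMap l (P.coroot i) • b.fundamentalWeight i := by
  apply P.toLinearMap.toPerfPair.injective
  refine b.toCoweightBasis.ext fun j ↦ ?_
  rw [map_sum, LinearMap.sum_apply]
  simp only [map_smul, LinearMap.smul_apply, LinearMap.toPerfPair_apply, fundamentalWeight_apply,
    Base.toCoweightBasis_apply, Base.toCoweightBasis_repr_coroot, smul_eq_mul]
  classical simp [Finsupp.single_apply]

/-- A coweight-space vector on which the whole weight lattice is integral lies in the coroot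
lattice. -/
lemma mem_corootLattice_of_forall_weightLattice [P.IsRootSystem] (b : P.Base) {v : N}
    (h : ∀ l ∈ P.weightLattice, ∃ n : ℤ, P.toLinearMap l v = n) : v ∈ P.corootLattice := by
  rw [← b.toCoweightBasis.sum_repr v]
  refine sum_mem fun i _ ↦ ?_
  obtain ⟨n, hn⟩ := h _ (fundamentalWeight_mem_weightLattice b i)
  rw [← fundamentalWeight_apply, hn, Int.cast_smul_eq_zsmul, Base.toCoweightBasis_apply]
  exact zsmul_mem (coroot_mem_corootLattice _) n

lemma exists_int_of_mem_corootLattice {v : N} (hv : v ∈ P.corootLattice) {l : M}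
    (hl : l ∈ P.weightLattice) : ∃ n : ℤ, P.toLinearMap l v = n := by
  induction hv using AddSubgroup.closure_induction with
  | mem x hx =>
    obtain ⟨i, rfl⟩ := hx
    exact hl i
  | zero => exact ⟨0, by simp⟩
  | add x y _ _ hx hy =>
    obtain ⟨m, hm⟩ := hx
    obtain ⟨n, hn⟩ := hy
    exact ⟨m + n, by simp [hm, hn]⟩
  | neg x _ hx =>
    obtain ⟨m, hm⟩ := hx
    exact ⟨-m, by simp [hm]⟩

/-! ### Logarithmic coordinates on the torus -/

/-- The point of the torus with logarithm `v + √-1 y`, that is,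
`l ↦ exp (2π √-1 (⟨l, v⟩ + √-1 ⟨l, y⟩))`. -/
def torusPoint (P : RootPairing ι ℝ M N) (v y : N) : P.Torus where
  toFun l := Units.mk0
    (Complex.exp (2 * Real.pi * Complex.I * ((P.toLinearMap (l.toAdd : M) v : ℝ) +
      (P.toLinearMap (l.toAdd : M) y : ℝ) * Complex.I)))
    (Complex.exp_ne_zero _)
  map_one' := by ext; simp
  map_mul' x y := by
    ext
    simp only [toAdd_mul, AddSubgroup.coe_add, map_add, LinearMap.add_apply, Complex.ofReal_add,
      Units.val_mk0, Units.val_mul, ← Complex.exp_add]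
    congr 1
    ring

lemma torusPoint_apply (v y : N) (l : P.weightLattice) :
    (P.torusPoint v y (.ofAdd l) : ℂ) = Complex.exp (2 * Real.pi * Complex.I *
      ((P.toLinearMap (l : M) v : ℝ) + (P.toLinearMap (l : M) y : ℝ) * Complex.I)) := rfl

lemma smul_torusPoint (w : P.weylGroup) (v y : N) :
    w • P.torusPoint v y = P.torusPoint (P.weylCoweightRep w v) (P.weylCoweightRep w y) := by
  refine MonoidHom.ext fun l ↦ Units.ext ?_
  obtain ⟨l, rfl⟩ := Multiplicative.ofAdd.surjective l
  rw [weylGroup_smul_torus_apply, torusPoint_apply, torusPoint_apply, weylCoweightRep_pairing,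
    weylCoweightRep_pairing]

lemma xPoint_mul_torusPoint (m : P.coweightLattice) (v y : N) :
    P.xPoint m * P.torusPoint v y = P.torusPoint (v - m) y := by
  refine MonoidHom.ext fun l ↦ Units.ext ?_
  obtain ⟨l, rfl⟩ := Multiplicative.ofAdd.surjective l
  rw [MonoidHom.mul_apply, Units.val_mul, torusPoint_apply, torusPoint_apply, map_sub]
  change Complex.exp _ * _ = _
  rw [← Complex.exp_add]
  congr 1
  push_cast
  simp only [toAdd_ofAdd]
  ring

lemma torusPoint_eq_iff [P.IsRootSystem] (b : P.Base) {v y v' y' : N} :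
    P.torusPoint v y = P.torusPoint v' y' ↔ v - v' ∈ P.corootLattice ∧ y = y' := by
  have key (l : P.weightLattice) :
      P.torusPoint v y (.ofAdd l) = P.torusPoint v' y' (.ofAdd l) ↔
        ∃ n : ℤ, P.toLinearMap (l : M) (v - v') = n ∧
          P.toLinearMap (l : M) y = P.toLinearMap (l : M) y' := by
    rw [← Units.val_inj, torusPoint_apply, torusPoint_apply, Complex.exp_eq_exp_iff_exists_int]
    refine exists_congr fun n ↦ ?_
    have h2 : (2 * Real.pi * Complex.I : ℂ) ≠ 0 := Complex.two_pi_I_ne_zero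
    rw [mul_comm (n : ℂ), ← mul_add, mul_right_inj' h2, Complex.ext_iff]
    simp [sub_eq_iff_eq_add']
  constructor
  · intro h
    have h' (l : M) (hl : l ∈ P.weightLattice) := (key ⟨l, hl⟩).1 (by rw [h])
    refine ⟨mem_corootLattice_of_forall_weightLattice b fun l hl ↦ (h' l hl).imp fun n hn ↦ hn.1,
      b.toCoweightBasis.repr.injective <| Finsupp.ext fun i ↦ ?_⟩
    obtain ⟨n, -, hn⟩ := h' _ (fundamentalWeight_mem_weightLattice b i)
    rwa [← fundamentalWeight_apply, ← fundamentalWeight_apply]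
  · rintro ⟨h, rfl⟩
    refine MonoidHom.ext fun l ↦ ?_
    obtain ⟨l, rfl⟩ := Multiplicative.ofAdd.surjective l
    obtain ⟨n, hn⟩ := exists_int_of_mem_corootLattice h l.2
    exact (key l).2 ⟨n, hn, rfl⟩

lemma exists_eq_torusPoint [P.IsRootSystem] (b : P.Base) (u : P.Torus) :
    ∃ v y : N, u = P.torusPoint v y := by
  let ω (i : b.support) : P.weightLattice :=
    ⟨b.fundamentalWeight i, fundamentalWeight_mem_weightLattice b i⟩
  have hz (i : b.support) : ∃ z : ℂ,
      (u (.ofAdd (ω i)) : ℂ) = Complex.exp (2 * Real.pi * Complex.I * z) := by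
    refine ⟨Complex.log (u (.ofAdd (ω i))) / (2 * Real.pi * Complex.I), ?_⟩
    rw [mul_div_cancel₀ _ Complex.two_pi_I_ne_zero, Complex.exp_log (Units.ne_zero _)]
  choose z hz using hz
  refine ⟨∑ i, (z i).re • b.toCoweightBasis i, ∑ i, (z i).im • b.toCoweightBasis i, ?_⟩
  -- both sides agree on the fundamental weights, which span the weight lattice
  have hω (i : b.support) : u (.ofAdd (ω i)) = P.torusPoint (∑ i, (z i).re • b.toCoweightBasis i)
      (∑ i, (z i).im • b.toCoweightBasis i) (.ofAdd (ω i)) := by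
    refine Units.ext ?_
    rw [hz, torusPoint_apply, fundamentalWeight_apply, fundamentalWeight_apply,
      Module.Basis.repr_sum_self, Module.Basis.repr_sum_self, Complex.re_add_im]
  refine MonoidHom.ext fun l ↦ ?_
  obtain ⟨l, rfl⟩ := Multiplicative.ofAdd.surjective l
  choose n hn using l.2
  have hl : l = ∑ i : b.support, n i • ω i := by
    refine Subtype.ext ?_
    rw [AddSubgroup.val_finsetSum]
    refine (eq_sum_fundamentalWeight b (l : M)).trans (Finset.sum_congr rfl fun i _ ↦ ?_)
    rw [hn, Int.cast_smul_eq_zsmul]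
    rfl
  rw [hl, ofAdd_sum, map_prod, map_prod]
  refine Finset.prod_congr rfl fun i _ ↦ ?_
  rw [ofAdd_zsmul, map_zpow, map_zpow, hω]

/-- The points `x_m` are fixed by the Weyl group, as it acts trivially on `P(R^∨) / Q(R^∨)`. -/
lemma smul_xPoint [P.IsRootSystem] (b : P.Base) (w : P.weylGroup) (m : P.coweightLattice)
    (u : P.Torus) :
    w • (P.xPoint m * u) = P.xPoint m * w • u := by
  obtain ⟨v, y, rfl⟩ := exists_eq_torusPoint b u
  rw [xPoint_mul_torusPoint, smul_torusPoint, smul_torusPoint, xPoint_mul_torusPoint,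
    torusPoint_eq_iff b]
  refine ⟨?_, rfl⟩
  rw [map_sub, sub_sub_sub_cancel_left, ← neg_sub]
  exact neg_mem (P.weylCoweightRep_sub_mem w m.2)

lemma isRegular_torusPoint_iff [P.IsRootSystem] (b : P.Base) {v y : N} :
    IsRegular (P.torusPoint v y) ↔ ∀ w : P.weylGroup, P.weylCoweightRep w v - v ∈ P.corootLattice →
      P.weylCoweightRep w y = y → w = 1 := by
  rw [IsRegular, Subgroup.eq_bot_iff_forall]
  refine forall_congr' fun w ↦ ?_
  rw [MulAction.mem_stabilizer_iff, smul_torusPoint, torusPoint_eq_iff b, and_imp]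

/-! ### Regular solutions of the fixed point equation -/

/-- If `v + √-1 y` is the logarithm of a regular point, then the line through `v` in the direction
`y` lies in no affine root hyperplane, since no affine reflection fixes both `v` and `y`. Each of
the countably many hyperplanes therefore excludes at most one point of the line. -/
lemma exists_add_smul_forall_root_ne_intCast [Finite ι] [P.IsRootSystem] (b : P.Base)
    {v y : N}
    (h : IsRegular (P.torusPoint v y)) :
    ∃ ε : ℝ, ∀ i (n : ℤ), P.toLinearMap (P.root i) (v + ε • y) ≠ n := by
  have hcount : (⋃ i, ⋃ n : ℤ,
      {ε : ℝ | P.toLinearMap (P.root i) (v + ε • y) = n}).Countable := by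
    refine Set.countable_iUnion fun i ↦ Set.countable_iUnion fun n ↦ Set.Subsingleton.countable ?_
    intro s hs t ht
    simp only [Set.mem_ofPred_eq, map_add, map_smul, smul_eq_mul] at hs ht
    have hst : (s - t) * P.toLinearMap (P.root i) y = 0 := by linarith
    rcases mul_eq_zero.1 hst with h0 | h0
    · exact sub_eq_zero.1 h0
    · rw [h0, mul_zero, add_zero] at hs
      refine absurd ((isRegular_torusPoint_iff b).1 h (weylGroup.ofIdx P i) ?_ ?_) (ofIdx_ne_one i)
      · rw [weylCoweightRep_ofIdx, hs, sub_sub_cancel_left, Int.cast_smul_eq_zsmul]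
        exact neg_mem (zsmul_mem (coroot_mem_corootLattice i) n)
      · rw [weylCoweightRep_ofIdx, h0, zero_smul, sub_zero]
  obtain ⟨ε, hε⟩ := hcount.dense_compl ℝ |>.nonempty
  refine ⟨ε, fun i n hin ↦ hε ?_⟩
  exact Set.mem_iUnion.2 ⟨i, Set.mem_iUnion.2 ⟨n, hin⟩⟩

variable [Finite ι] [P.IsRootSystem] [P.IsCrystallographic] [P.IsReduced]

lemma isRegular_torusPoint_of_mem_fundamentalAlcove {b : P.Base} {v : N}
    (hv : v ∈ b.fundamentalAlcove) : IsRegular (P.torusPoint v 0) := by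
  refine (isRegular_torusPoint_iff b).2 fun w hw _ ↦ ?_
  rw [← neg_mem_iff, neg_sub] at hw
  let g : P.ExtendedWeylGroup := ⟨.ofAdd ⟨v - P.weylCoweightRep w v,
    corootLattice_le_coweightLattice hw⟩, w⟩
  have hgv : P.extendedWeylAction g v = v := sub_add_cancel _ _
  have hg : g = 1 := eq_one_of_mem_alcoveStabilizer_of_mem_ker
    (mem_alcoveStabilizer_of_mem hv (hgv.symm ▸ hv))
    (mem_ker_extendedWeylToQuotient.2 hw)
  exact congrArg SemidirectProduct.right hg

lemma psi_eq_of_mem_alcoveStabilizer {b : P.Base} {g : P.ExtendedWeylGroup}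
    (hg : g ∈ b.alcoveStabilizer) : b.psi (P.extendedWeylToQuotient g) = g.right := by
  have h1 : (MulEquiv.ofBijective b.xi (xi_bijective b)).symm (P.extendedWeylToQuotient g) =
      ⟨g, hg⟩ := by
    rw [MulEquiv.symm_apply_eq]
    rfl
  rw [Base.psi, dif_pos (xi_bijective b)]
  change SemidirectProduct.rightHom (b.alcoveStabilizer.subtype
    ((MulEquiv.ofBijective b.xi (xi_bijective b)).symm (P.extendedWeylToQuotient g))) = _
  rw [h1]
  rfl

/-- If a regular point `u` with logarithm `v + √-1 y` satisfies `h u = x_μ u`, an element of `W_e`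
over `h` and the class of `μ` fixes a point `v + ε y` off all affine root hyperplanes, and a
conjugate of it by an element of the affine Weyl group lies in `Γ_C`. -/
lemma isConj_psi_of_smul_eq {b : P.Base} {μ : P.coweightLattice} {h : P.weylGroup} {u : P.Torus}
    (hu : RootPairing.IsRegular u) (hfix : h • u = P.xPoint μ * u) :
    IsConj h (b.psi (.ofAdd (QuotientAddGroup.mk μ))) := by
  obtain ⟨v, y, rfl⟩ := exists_eq_torusPoint b u
  rw [smul_torusPoint, xPoint_mul_torusPoint, torusPoint_eq_iff b] at hfix
  obtain ⟨hv, hy⟩ := hfix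
  obtain ⟨ε, hε⟩ := exists_add_smul_forall_root_ne_intCast b hu
  obtain ⟨a, ha, hac⟩ := exists_extendedWeylAction_mem_fundamentalAlcove b hε
  have hmem : v - P.weylCoweightRep h v - μ ∈ P.corootLattice := by
    have := neg_mem hv
    rwa [neg_sub, sub_right_comm] at this
  let g : P.ExtendedWeylGroup := ⟨.ofAdd ⟨v - P.weylCoweightRep h v, by
    simpa using add_mem (corootLattice_le_coweightLattice hmem) μ.2⟩, h⟩
  have hg : P.extendedWeylAction g (v + ε • y) = v + ε • y := by
    rw [extendedWeylAction_apply]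
    change (v - P.weylCoweightRep h v) + P.weylCoweightRep h (v + ε • y) = _
    rw [map_add, map_smul, hy]
    abel
  have hgq : P.extendedWeylToQuotient g = .ofAdd (QuotientAddGroup.mk μ) := by
    refine congrArg Multiplicative.ofAdd (QuotientAddGroup.eq.2 ?_)
    rw [AddSubgroup.mem_addSubgroupOf]
    convert neg_mem hmem using 1
    change -(v - P.weylCoweightRep h v) + (μ : N) = _
    abel
  have hstab : a * g * a⁻¹ ∈ b.alcoveStabilizer := by
    refine mem_alcoveStabilizer_of_mem hac ?_
    rw [← Equiv.Perm.mul_apply, ← map_mul, inv_mul_cancel_right, map_mul, Equiv.Perm.mul_apply,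
      hg]
    exact hac
  have hpsi := psi_eq_of_mem_alcoveStabilizer hstab
  have hq : P.extendedWeylToQuotient (a * g * a⁻¹) = .ofAdd (QuotientAddGroup.mk μ) := by
    rw [map_mul, map_mul, map_inv, MonoidHom.mem_ker.1 ha, one_mul, inv_one, mul_one, hgq]
  rw [hq] at hpsi
  rw [hpsi]
  refine isConj_iff.2 ⟨a.right, ?_⟩
  change SemidirectProduct.rightHom a * SemidirectProduct.rightHom g *
    (SemidirectProduct.rightHom a)⁻¹ = SemidirectProduct.rightHom (a * g * a⁻¹)
  rw [map_mul, map_mul, map_inv]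

/-- The exponential of a point of the alcove fixed by an element of `Γ_C` is a regular solution
for the image of that element in `W`; conjugates are reached by translating it by `W`. -/
lemma exists_isRegular_of_isConj_psi {b : P.Base} {μ : P.coweightLattice} {h : P.weylGroup}
    (hconj : IsConj h (b.psi (.ofAdd (QuotientAddGroup.mk μ)))) :
    ∃ u : P.Torus, RootPairing.IsRegular u ∧ h • u = P.xPoint μ * u := by
  obtain ⟨⟨g, hg⟩, hgq⟩ := (xi_bijective b).2 (.ofAdd (QuotientAddGroup.mk μ))
  replace hgq : P.extendedWeylToQuotient g = .ofAdd (QuotientAddGroup.mk μ) := hgq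
  rw [← hgq, psi_eq_of_mem_alcoveStabilizer hg] at hconj
  obtain ⟨k, hk⟩ := isConj_iff.1 hconj.symm
  obtain ⟨v, hv, hgv⟩ := exists_fixed_of_mem_alcoveStabilizer hg
  have hfix : g.right • P.torusPoint v 0 = P.xPoint μ * P.torusPoint v 0 := by
    rw [smul_torusPoint, xPoint_mul_torusPoint, torusPoint_eq_iff b, map_zero]
    refine ⟨?_, rfl⟩
    rw [extendedWeylAction_apply] at hgv
    have h1 := QuotientAddGroup.eq.1 (congrArg Multiplicative.toAdd hgq)
    rw [AddSubgroup.mem_addSubgroupOf] at h1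
    convert h1 using 1
    change _ = -(g.left.toAdd : N) + (μ : N)
    nth_rw 2 [← hgv]
    abel
  refine ⟨k • P.torusPoint v 0, ?_, ?_⟩
  · rw [RootPairing.IsRegular, MulAction.stabilizer_smul_eq_stabilizer_map_conj,
      show MulAction.stabilizer P.weylGroup (P.torusPoint v 0) = ⊥ from
        isRegular_torusPoint_of_mem_fundamentalAlcove hv, Subgroup.map_bot]
  · rw [← hk, smul_smul, inv_mul_cancel_right, mul_smul, hfix, smul_xPoint b]

end RootPairing

end

theorem mainTheorem5 {ι M N : Type*} [Finite ι] [AddCommGroup M] [Module ℝ M]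
    [AddCommGroup N] [Module ℝ N] (P : RootPairing ι ℝ M N)
    [P.IsRootSystem] [P.IsCrystallographic] [P.IsReduced] (b : P.Base)
    (μ : P.coweightLattice) (h : P.weylGroup) :
    (∃ u : P.Torus, RootPairing.IsRegular u ∧ h • u = P.xPoint μ * u) ↔
      IsConj h (b.psi (.ofAdd (QuotientAddGroup.mk μ))) := by
  exact ⟨fun ⟨_, hu, hfix⟩ ↦ RootPairing.isConj_psi_of_smul_eq hu hfix,
    RootPairing.exists_isRegular_of_isConj_psi⟩
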